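/- Let $\mathscr H$ be a complex Hilbert space of arbitrary dimension and let $\mathbb B(\mathscr H)$ be the algebra of bounded linear operators on $\mathscr H$. Let $\mathfrak J\subseteq\mathbb B(\mathscr H)$ be a two-sided ideal and let $|||\cdot|||$ be a unitarily invariant norm on $\mathfrak J$, that is, a norm with $|||UXV|||=|||X|||$ for all $X\in\mathfrak J$ and all unitary operators $U,V$ on $\mathscr H$. Write $|T|=(T^*T)^{1/2}$. Then for all $A,B\in\mathbb B(\mathscr H)$, every real $t\le 2$ and every $X\in\mathfrak J$, $$\big|\big|\big|\,A^*AX+XB^*B+t\,|A|\,X\,|B|\,\big|\big|\big|\ \ge\ (t+2)\,\big|\big|\big|AXB^*\big|\big|\big| .$$ (Equivalently, replacing $B$ by $B^*$: $|||A^*AX+XBB^*+t|A|X|B^*|\,|||\ge(t+2)|||AXB|||$.) -/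

import Mathlib

/-- A unitarily invariant norm `|||·|||` on the bounded operators of a complex Hilbert space `H`,
together with the two-sided ideal of `B(H)` on which it is defined (its norm ideal). -/
structure UnitarilyInvariantNorm (H : Type*) [NormedAddCommGroup H] [InnerProductSpace ℂ H]
    [CompleteSpace H] where
  /-- the norm ideal, a linear subspace of `B(H)` stable under multiplication on both sides -/
  ideal : Submodule ℂ (H →L[ℂ] H)
  mul_mem_left : ∀ (S : H →L[ℂ] H) {X : H →L[ℂ] H}, X ∈ ideal → S * X ∈ ideal
  mul_mem_right : ∀ (S : H →L[ℂ] H) {X : H →L[ℂ] H}, X ∈ ideal → X * S ∈ ideal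
  /-- the norm; `Seminorm` gives the triangle inequality and absolute homogeneity -/
  norm : Seminorm ℂ ideal
  eq_zero_of_norm_eq_zero : ∀ X : ideal, norm X = 0 → X = 0
  norm_unitary_mul_mul : ∀ (U V : unitary (H →L[ℂ] H)) (X : ideal),
    norm ⟨(U : H →L[ℂ] H) * (X : H →L[ℂ] H) * (V : H →L[ℂ] H),
      mul_mem_right _ (mul_mem_left _ X.2)⟩ = norm X

namespace UnitarilyInvariantNorm

variable {H : Type*} [NormedAddCommGroup H] [InnerProductSpace ℂ H] [CompleteSpace H]

theorem mul_mul_mem (N : UnitarilyInvariantNorm H) (S T : H →L[ℂ] H) {X : H →L[ℂ] H}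
    (hX : X ∈ N.ideal) : S * X * T ∈ N.ideal :=
  N.mul_mem_right T (N.mul_mem_left S hX)

end UnitarilyInvariantNorm

/-!
Write `p` for the norm. Multiplication by a contraction on either side does not increase `p`: by
the Russo–Dye averaging argument (`Seminorm.le_mul_norm_of_forall_unitary`) this follows from
unitary invariance alone. Neither the ideal nor `p` is assumed to be complete or continuous for the
operator norm, so every limit below is a limit of real numbers.

For `t ≤ -2` the right-hand side is nonpositive. For `-2 ≤ t ≤ 2`, the operator `A` is a
contraction times `|A| + ε`, and likewise for `B`. This reduces the claim to the inequality
`(t + 2) p(P X Q) ≤ p(P² X + X Q² + t P X Q)` for `P = |A| + ε` and `Q = |B| + ε`, followed by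
`ε → 0`.

Since `P` is the exponential of a self-adjoint `α`, for every `n = 2 ^ k` there is a self-adjoint
`γ = tanh (α / 2n)` with `‖γ‖ ≤ ‖α‖ / n` and `(1 - γ)ⁿ P = (1 + γ)ⁿ`; let `η` be the analogous
operator for `Q = exp β`. Put `X = (1 - γ)²ⁿ W (1 - η)²ⁿ`, and let `a`, `b` be the
commuting maps `W ↦ (1 + γ) W (1 - η)` and `W ↦ (1 - γ) W (1 + η)`. Then
`P² X + X Q² + t P X Q = (a²ⁿ + t aⁿ bⁿ + b²ⁿ) W`, while `P X Q = aⁿ bⁿ W` has `p`-norm at most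
`p(W)`.

The polynomial `a²ⁿ + t aⁿ bⁿ + b²ⁿ` is a product of `2n` factors `a - z b` with `|z| = 1`. For
`z ≠ 1` such a factor is `1 - z` times a map `W ↦ W + i τ (γ W - W η) - γ W η` with `τ` real. As
`1 + i s γ` and `1 - i s η`, `s` real, have contractive inverses,
`W ↦ W + i τ (γ W - W η)` does not decrease `p`
(`UnitarilyInvariantNorm.norm_le_norm_add_I_smul_commutator`), and the last term costs at most
`‖γ‖ ‖η‖ p(W) = O(n⁻²) p(W)`. The product of the numbers `|1 - z|` is `t + 2`, so the whole product
is bounded below by `(t + 2) (1 - O(n⁻²))²ⁿ p(W)`, and `n → ∞` gives the claim.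
-/

/-! ### Unitaries, contractions and Cayley roots in C⋆-algebras -/

section CStarAlgebra

variable {𝒜 : Type*} [CStarAlgebra 𝒜]

theorem IsSelfAdjoint.exists_contraction_inverse_one_add_I_smul {a : 𝒜} (ha : IsSelfAdjoint a) :
    ∃ K : 𝒜, ‖K‖ ≤ 1 ∧ K * (1 + Complex.I • a) = 1 ∧ (1 + Complex.I • a) * K = 1 := by
  have hre : ∀ z ∈ spectrum ℂ a, 1 ≤ ‖1 + Complex.I * z‖ := by
    intro z hz
    have him : z.im = 0 := ha.im_eq_zero_of_mem_spectrum hz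
    refine le_trans ?_ (Complex.abs_re_le_norm _)
    simp [him]
  have hne : ∀ z ∈ spectrum ℂ a, 1 + Complex.I * z ≠ 0 := fun z hz h => by
    have := hre z hz
    rw [h, norm_zero] at this
    linarith
  have hc : ContinuousOn (fun z : ℂ => (1 + Complex.I * z)⁻¹) (spectrum ℂ a) :=
    ContinuousOn.inv₀ (by fun_prop) hne
  have hn : IsStarNormal a := ha.isStarNormal
  have hK : 1 + Complex.I • a = cfc (fun z : ℂ => 1 + Complex.I * z) a := by
    rw [cfc_const_add .., cfc_const_mul .., cfc_id' ..]
    simp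
  refine ⟨cfc (fun z : ℂ => (1 + Complex.I * z)⁻¹) a, ?_, ?_, ?_⟩
  · refine norm_cfc_le zero_le_one fun z hz => ?_
    rw [norm_inv]
    exact inv_le_one_of_one_le₀ (hre z hz)
  · rw [hK, ← cfc_mul _ _ a hc (by fun_prop), ← cfc_one ℂ a]
    exact cfc_congr fun z hz => inv_mul_cancel₀ (hne z hz)
  · rw [hK, ← cfc_mul _ _ a (by fun_prop) hc, ← cfc_one ℂ a]
    exact cfc_congr fun z hz => mul_inv_cancel₀ (hne z hz)

/-- With `γ = tanh (α / 2N)`, the Cayley transform `(1 + γ) / (1 - γ)` is an `N`-th root of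
`exp α`. -/
theorem IsSelfAdjoint.exists_cayley_root_exp {α : 𝒜} (hα : IsSelfAdjoint α) {N : ℕ} (hN : 0 < N) :
    ∃ γ : 𝒜, IsSelfAdjoint γ ∧ ‖γ‖ ≤ ‖α‖ / N ∧ ‖1 - γ ^ 2‖ ≤ 1 ∧ IsUnit (1 - γ) ∧
      Commute γ (NormedSpace.exp α) ∧ (1 - γ) ^ N * NormedSpace.exp α = (1 + γ) ^ N := by
  have hN' : (0 : ℝ) < N := by exact_mod_cast hN
  -- `f x = tanh (x / 2N)`
  set f : ℝ → ℝ := fun x => (Real.exp (x / N) - 1) / (Real.exp (x / N) + 1) with hf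
  have hfc : Continuous f := by
    refine Continuous.div (by fun_prop) (by fun_prop) fun x => ?_
    positivity
  have hexp : NormedSpace.exp α = cfc Real.exp α := (CFC.real_exp_eq_normedSpace_exp hα).symm
  have h1f : ∀ x, 1 - f x = 2 / (Real.exp (x / N) + 1) := by
    intro x
    have : Real.exp (x / N) + 1 ≠ 0 := by positivity
    rw [hf]; field_simp; ring
  have h2f : ∀ x, 1 + f x = Real.exp (x / N) * (1 - f x) := by
    intro x
    have : Real.exp (x / N) + 1 ≠ 0 := by positivity
    rw [hf]; field_simp; ring
  have hsub : 1 - cfc f α = cfc (fun x => 1 - f x) α := by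
    rw [cfc_sub (fun _ => 1) f α, cfc_const_one ..]
  have hadd : 1 + cfc f α = cfc (fun x => 1 + f x) α := by
    rw [cfc_const_add .., map_one]
  refine ⟨cfc f α, cfc_predicate _ _, ?_, ?_, ?_, ?_, ?_⟩
  · refine norm_cfc_le (by positivity) fun x hx => ?_
    rcases subsingleton_or_nontrivial 𝒜 with h | h
    · simp at hx
    have hx' : |x| / N ≤ ‖α‖ / N := by
      gcongr
      exact spectrum.norm_le_norm_of_mem hx
    refine le_trans ?_ hx'
    have hv : |x| / N = |x / N| := by rw [abs_div, abs_of_pos hN']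
    rw [hv, Real.norm_eq_abs, hf]
    set v := x / N
    have hE := Real.exp_pos v
    rw [abs_div, abs_of_pos (show 0 < Real.exp v + 1 by positivity), div_le_iff₀ (by positivity)]
    have l1 : v + 1 ≤ Real.exp v := Real.add_one_le_exp v
    have l2 : Real.exp v - 1 ≤ v * Real.exp v := by
      have := Real.add_one_le_exp (-v)
      have h3 : Real.exp (-v) * Real.exp v = 1 := by rw [← Real.exp_add]; simp
      nlinarith
    have l3 := le_abs_self v
    have l4 := neg_abs_le v
    rw [abs_le]
    constructor <;> nlinarith [mul_nonneg (abs_nonneg v) hE.le]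
  · have : 1 - cfc f α ^ 2 = cfc (fun x => 1 - f x ^ 2) α := by
      rw [cfc_sub (fun _ => 1) (fun x => f x ^ 2) α, cfc_pow .., cfc_const_one ..]
    rw [this]
    refine norm_cfc_le zero_le_one fun x hx => ?_
    have h0 : 0 < 1 - f x := by rw [h1f]; positivity
    have h0' : 0 < 1 + f x := by rw [h2f]; positivity
    rw [Real.norm_eq_abs, abs_le]
    constructor <;> nlinarith [sq_nonneg (f x)]
  · rw [hsub, isUnit_cfc_iff ..]
    intro x hx
    rw [h1f]; positivity
  · rw [hexp]; exact cfc_commute_cfc _ _ _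
  · rw [hsub, hadd, hexp, ← cfc_pow (fun x => 1 - f x) N α (by fun_prop),
      ← cfc_pow (fun x => 1 + f x) N α (by fun_prop),
      ← cfc_mul (fun x => (1 - f x) ^ N) Real.exp α (by fun_prop) (by fun_prop)]
    refine cfc_congr fun x _ => ?_
    rw [h2f, mul_pow, ← Real.exp_nat_mul, mul_div_cancel₀ _ hN'.ne', mul_comm]

variable [PartialOrder 𝒜] [StarOrderedRing 𝒜]

/-- An invertible contraction is the mean of two unitaries: in the polar decomposition `T = W |T|`,
the factor `|T|` is the real part of the unitary `|T| + i √(1 - |T|²)`. -/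
theorem IsUnit.exists_unitary_two_smul_eq_add {T : 𝒜} (hT : IsUnit T) (hT1 : ‖T‖ ≤ 1) :
    ∃ U V : unitary 𝒜, (2 : ℝ) • T = (U : 𝒜) + V := by
  have habs : IsUnit (CFC.abs T) := by
    have h : IsUnit (CFC.abs T ^ 2) := by
      rw [CFC.abs_sq]; exact hT.star.mul hT
    exact (isUnit_pow_iff two_ne_zero).1 h
  obtain ⟨P, hP⟩ := habs
  have hsa : star (P : 𝒜) = P := by rw [hP]; exact (CFC.abs_nonneg T).isSelfAdjoint
  have hsa' : star ((P⁻¹ : 𝒜ˣ) : 𝒜) = (P⁻¹ : 𝒜ˣ) := by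
    have : star P = P := Units.ext hsa
    rw [← Units.coe_star, star_inv, this]
  have hsq : star T * T = P * P := by rw [hP, CFC.abs_mul_abs]
  have hW1 : star (T * (P⁻¹ : 𝒜ˣ)) * (T * (P⁻¹ : 𝒜ˣ)) = 1 := by
    rw [star_mul, hsa']
    calc ((P⁻¹ : 𝒜ˣ) : 𝒜) * star T * (T * (P⁻¹ : 𝒜ˣ))
        = (P⁻¹ : 𝒜ˣ) * (star T * T) * (P⁻¹ : 𝒜ˣ) := by simp only [mul_assoc]
      _ = 1 := by rw [hsq]; simp
  have hW : T * (P⁻¹ : 𝒜ˣ) ∈ unitary 𝒜 := by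
    refine Unitary.mem_iff.2 ⟨hW1, ?_⟩
    have hu : IsUnit (T * (P⁻¹ : 𝒜ˣ)) := hT.mul (Units.isUnit _)
    obtain ⟨w, hw⟩ := hu
    rw [← hw] at hW1 ⊢
    rw [← Units.inv_eq_of_mul_eq_one_left hW1, Units.mul_inv]
  let a : selfAdjoint 𝒜 := ⟨CFC.abs T, (CFC.abs_nonneg T).isSelfAdjoint⟩
  have ha : ‖a‖ ≤ 1 := by
    change ‖CFC.abs T‖ ≤ 1
    rwa [CFC.norm_abs]
  let V := selfAdjoint.unitarySelfAddISMul a ha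
  refine ⟨⟨_, hW⟩ * V, ⟨_, hW⟩ * star V, ?_⟩
  have hV : (V : 𝒜) + (star V : unitary 𝒜) = (2 : ℝ) • (P : 𝒜) := by
    rw [Unitary.coe_star, selfAdjoint.star_coe_unitarySelfAddISMul,
      selfAdjoint.unitarySelfAddISMul_coe, hP, two_smul]
    simp [a]
  simp only [Submonoid.coe_mul]
  rw [← mul_add, hV, mul_smul_comm, mul_assoc]
  simp

/-- Gardner's lemma: `S + U = U (1 + U⋆ S)` is invertible, so half of it is the mean of two
unitaries. -/
theorem exists_unitary_add_eq_add {S : 𝒜} (hS : ‖S‖ < 1) (U : unitary 𝒜) :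
    ∃ V W : unitary 𝒜, S + U = (V : 𝒜) + W := by
  have hn : ‖-(star (U : 𝒜) * S)‖ < 1 := by
    rw [norm_neg, ← Unitary.coe_star, CStarRing.norm_coe_unitary_mul]; exact hS
  have hu : IsUnit ((2⁻¹ : ℝ) • (S + U)) := by
    have h1 : IsUnit (1 - -(star (U : 𝒜) * S)) := isUnit_one_sub_of_norm_lt_one hn
    have h2 : S + U = U * (1 - -(star (U : 𝒜) * S)) := by
      rw [sub_neg_eq_add, mul_add, ← mul_assoc]; simp [add_comm]
    have h3 : IsUnit (S + U) := h2 ▸ (Unitary.isUnit_coe).mul h1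
    exact (IsUnit.smul (Units.mk0 (2⁻¹ : ℝ) (by norm_num)) h3 :)
  have hU : ‖(U : 𝒜)‖ ≤ 1 := by
    rcases subsingleton_or_nontrivial 𝒜 with h | h
    · simp [Subsingleton.elim (U : 𝒜) 0]
    · exact (CStarRing.norm_coe_unitary U).le
  have hle : ‖(2⁻¹ : ℝ) • (S + U)‖ ≤ 1 := by
    rw [norm_smul]
    have := norm_add_le S (U : 𝒜)
    norm_num
    linarith
  obtain ⟨V, W, h⟩ := hu.exists_unitary_two_smul_eq_add hle
  exact ⟨V, W, by rw [← h, smul_smul]; norm_num⟩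

/-- A seminorm version of the Russo–Dye theorem. No continuity of `q` is needed, because Gardner's
lemma writes `n • S + V` as a sum of exactly `n + 1` unitaries when `‖S‖ < 1`. -/
theorem Seminorm.le_mul_norm_of_forall_unitary (q : Seminorm ℂ 𝒜) {c : ℝ}
    (hq : ∀ U : unitary 𝒜, q U ≤ c) (S : 𝒜) : q S ≤ c * ‖S‖ := by
  have hc : 0 ≤ c := (apply_nonneg q _).trans (hq 1)
  have step : ∀ T : 𝒜, ‖T‖ < 1 → q T ≤ c := by
    intro T hT
    have hind : ∀ (n : ℕ) (V : unitary 𝒜), q ((n : ℂ) • T + V) ≤ (n + 1) * c := by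
      intro n
      induction n with
      | zero => intro V; simpa using hq V
      | succ n ih =>
        intro V
        obtain ⟨V', W', h⟩ := exists_unitary_add_eq_add hT V
        have e : ((n + 1 : ℕ) : ℂ) • T + (V : 𝒜) = ((n : ℂ) • T + V') + W' := by
          rw [add_assoc, ← h]; push_cast; module
        rw [e]
        refine (map_add_le_add q _ _).trans ?_
        have := ih V'
        have := hq W'
        push_cast
        linarith
    have hn : ∀ n : ℕ, n * (q T - c) ≤ 2 * c := by
      intro n
      have h1 : (n : ℂ) • T = ((n : ℂ) • T + (1 : unitary 𝒜)) - (1 : unitary 𝒜) := by simp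
      have h2 : q ((n : ℂ) • T) = n * q T := by rw [map_smul_eq_mul]; simp
      have h3 : q ((n : ℂ) • T) ≤ (n + 1) * c + c := by
        rw [h1]
        exact (map_sub_le_add q _ _).trans (add_le_add (hind n 1) (hq 1))
      linarith
    by_contra! hlt
    obtain ⟨n, hn'⟩ := exists_nat_gt (2 * c / (q T - c))
    rw [div_lt_iff₀ (by linarith)] at hn'
    linarith [hn n]
  refine le_of_forall_pos_le_add fun ε hε => ?_
  have hδ : 0 < ε / (c + 1) := by positivity
  set r : ℝ := ‖S‖ + ε / (c + 1) with hr
  have hr0 : 0 < r := by positivity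
  have h1 : ‖((r⁻¹ : ℝ) : ℂ) • S‖ < 1 := by
    rw [norm_smul, Complex.norm_real, Real.norm_of_nonneg (by positivity), inv_mul_lt_iff₀ hr0]
    linarith
  have h2 := step _ h1
  rw [map_smul_eq_mul, Complex.norm_real, Real.norm_of_nonneg (by positivity),
    inv_mul_le_iff₀ hr0] at h2
  have h3 : ε / (c + 1) * c ≤ ε := by
    rw [div_mul_eq_mul_div, div_le_iff₀ (by positivity)]
    nlinarith
  calc q S ≤ r * c := h2
    _ = c * ‖S‖ + ε / (c + 1) * c := by rw [hr]; ring
    _ ≤ _ := by linarith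

/-- A substitute for the polar decomposition `a = U |a|`, with no partial isometry needed:
`K = a (|a| + ε)⁻¹` is a contraction because `‖K‖ = ‖|a| (|a| + ε)⁻¹‖`. -/
theorem exists_contraction_mul_abs_add_smul_one (a : 𝒜) {ε : ℝ} (hε : 0 < ε) :
    ∃ K : 𝒜, ‖K‖ ≤ 1 ∧ K * (CFC.abs a + ε • 1) = a := by
  have hsa : IsSelfAdjoint (CFC.abs a) := (CFC.abs_nonneg a).isSelfAdjoint
  have hpos : ∀ x ∈ spectrum ℝ (CFC.abs a), 0 ≤ x := fun x hx =>
    spectrum_nonneg_of_nonneg (CFC.abs_nonneg a) hx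
  have hne : ∀ x ∈ spectrum ℝ (CFC.abs a), x + ε ≠ 0 := fun x hx => by
    have := hpos x hx
    positivity
  have hc : ContinuousOn (fun x : ℝ => (x + ε)⁻¹) (spectrum ℝ (CFC.abs a)) :=
    ContinuousOn.inv₀ (by fun_prop) hne
  have hP : CFC.abs a + ε • 1 = cfc (fun x : ℝ => x + ε) (CFC.abs a) := by
    rw [cfc_add_const .., cfc_id' .., Algebra.algebraMap_eq_smul_one]
  set Q := cfc (fun x : ℝ => (x + ε)⁻¹) (CFC.abs a) with hQ
  have hQsa : star Q = Q := (cfc_predicate _ _ : IsSelfAdjoint Q)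
  have hQP : Q * (CFC.abs a + ε • 1) = 1 := by
    rw [hP, hQ, ← cfc_mul _ _ (CFC.abs a) hc (by fun_prop), ← cfc_one ℝ (CFC.abs a)]
    exact cfc_congr fun x hx => inv_mul_cancel₀ (hne x hx)
  refine ⟨a * Q, ?_, by rw [mul_assoc, hQP, mul_one]⟩
  -- `Q = (|a| + ε)⁻¹`
  have hle : ‖CFC.abs a * Q‖ ≤ 1 := by
    have : CFC.abs a * Q = cfc (fun x : ℝ => x * (x + ε)⁻¹) (CFC.abs a) := by
      rw [cfc_mul _ _ (CFC.abs a) (by fun_prop) hc, cfc_id' ..]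
    rw [this]
    refine norm_cfc_le zero_le_one fun x hx => ?_
    have := hpos x hx
    rw [Real.norm_of_nonneg (by positivity), ← div_eq_mul_inv, div_le_one (by positivity)]
    linarith
  have hsq : ‖a * Q‖ * ‖a * Q‖ = ‖CFC.abs a * Q‖ * ‖CFC.abs a * Q‖ := by
    rw [← CStarRing.norm_star_mul_self, ← CStarRing.norm_star_mul_self, star_mul, star_mul,
      hsa.star_eq, mul_assoc, mul_assoc, ← mul_assoc (star a), ← mul_assoc (CFC.abs a),
      CFC.abs_mul_abs]
  nlinarith [norm_nonneg (a * Q), norm_nonneg (CFC.abs a * Q)]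

end CStarAlgebra

/-! ### Products of commuting linear factors under a seminorm -/

section Seminorm

variable {E : Type*} [AddCommGroup E] [Module ℂ E]

/-- A lower bound for all factors `a - z b`, `|z| = 1`, passes to `aⁿ - z bⁿ` with `n = 2 ^ k`:
induct on `k` via `x² - w² y² = (x - w y) (x + w y)`, where `|1 - w| |1 + w| = |1 - w²|`. -/
theorem Seminorm.norm_one_sub_mul_pow_le (p : Seminorm ℂ E) {a b : Module.End ℂ E}
    (hab : Commute a b) {c : ℝ} (hc : 0 ≤ c)
    (h : ∀ z : ℂ, ‖z‖ = 1 → ∀ W, ‖1 - z‖ * c * p W ≤ p ((a - z • b) W)) (k : ℕ) :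
    ∀ z : ℂ, ‖z‖ = 1 → ∀ W,
      ‖1 - z‖ * c ^ 2 ^ k * p W ≤ p ((a ^ 2 ^ k - z • b ^ 2 ^ k) W) := by
  induction k with
  | zero => simpa using h
  | succ k ih =>
    intro z hz W
    obtain ⟨w, rfl⟩ : ∃ w : ℂ, z = w ^ 2 := by
      obtain ⟨w, hw⟩ := IsAlgClosed.exists_pow_nat_eq z (n := 2) two_pos
      exact ⟨w, hw.symm⟩
    have hw : ‖w‖ = 1 := by
      rw [norm_pow] at hz
      exact (pow_eq_one_iff_of_nonneg (norm_nonneg w) two_ne_zero).1 hz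
    have hc2 : Commute (a ^ 2 ^ k) (b ^ 2 ^ k) := hab.pow_pow _ _
    have e : a ^ 2 ^ (k + 1) - w ^ 2 • b ^ 2 ^ (k + 1)
        = (a ^ 2 ^ k - w • b ^ 2 ^ k) * (a ^ 2 ^ k - (-w) • b ^ 2 ^ k) := by
      rw [pow_succ 2 k, pow_mul, pow_mul, sub_mul, mul_sub, mul_sub, smul_mul_assoc,
        smul_mul_assoc, mul_smul_comm, mul_smul_comm, ← hc2.eq, sq (a ^ 2 ^ k), sq (b ^ 2 ^ k)]
      module
    have h1 := ih w hw ((a ^ 2 ^ k - (-w) • b ^ 2 ^ k) W)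
    have h2 := ih (-w) (by rwa [norm_neg]) W
    rw [e, Module.End.mul_apply]
    refine le_trans ?_ h1
    have hn : ‖1 - w ^ 2‖ = ‖1 - w‖ * ‖1 - -w‖ := by rw [← norm_mul]; ring_nf
    calc ‖1 - w ^ 2‖ * c ^ 2 ^ (k + 1) * p W
        = ‖1 - w‖ * c ^ 2 ^ k * (‖1 - -w‖ * c ^ 2 ^ k * p W) := by rw [hn]; ring
      _ ≤ _ := by gcongr

/-- For `-2 ≤ t ≤ 2` the form `x² + t x y + y²` splits as `(x - z y) (x - z̄ y)` with `|z| = 1`, and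
`|1 - z|² = t + 2`. -/
theorem Seminorm.add_two_mul_pow_le (p : Seminorm ℂ E) {a b : Module.End ℂ E}
    (hab : Commute a b) {c : ℝ} (hc : 0 ≤ c)
    (h : ∀ z : ℂ, ‖z‖ = 1 → ∀ W, ‖1 - z‖ * c * p W ≤ p ((a - z • b) W)) (k : ℕ)
    {t : ℝ} (ht : t ∈ Set.Icc (-2) 2) (W : E) :
    (t + 2) * (c ^ 2 ^ k) ^ 2 * p W ≤
      p (((a ^ 2 ^ k) ^ 2 + (b ^ 2 ^ k) ^ 2 + (t : ℂ) • (a ^ 2 ^ k * b ^ 2 ^ k)) W) := by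
  -- `z` is the unimodular root of `z² + t z + 1 = 0` in the upper half-plane
  set s : ℝ := √(1 - (t / 2) ^ 2) with hs
  have hs2 : s ^ 2 = 1 - (t / 2) ^ 2 := Real.sq_sqrt (by nlinarith [ht.1, ht.2])
  set z : ℂ := ⟨-t / 2, s⟩ with hz
  have hz1 : ‖z‖ = 1 := by
    have h1 : ‖z‖ ^ 2 = 1 := by
      rw [← Complex.normSq_eq_norm_sq, Complex.normSq_apply]
      linear_combination hs2
    exact (pow_eq_one_iff_of_nonneg (norm_nonneg z) two_ne_zero).1 h1
  have hzc : ‖(starRingEnd ℂ) z‖ = 1 := by rwa [Complex.norm_conj]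
  have hc2 : Commute (a ^ 2 ^ k) (b ^ 2 ^ k) := hab.pow_pow _ _
  have hsum : z + (starRingEnd ℂ) z = -(t : ℂ) := by
    rw [Complex.add_conj]; simp [hz]; ring
  have ht' : (t : ℂ) = -(z + (starRingEnd ℂ) z) := by rw [hsum, neg_neg]
  have hprod : z * (starRingEnd ℂ) z = 1 := by
    rw [Complex.mul_conj, Complex.normSq_eq_norm_sq, hz1]; simp
  have e : (a ^ 2 ^ k) ^ 2 + (b ^ 2 ^ k) ^ 2 + (t : ℂ) • (a ^ 2 ^ k * b ^ 2 ^ k)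
      = (a ^ 2 ^ k - z • b ^ 2 ^ k) * (a ^ 2 ^ k - (starRingEnd ℂ z) • b ^ 2 ^ k) := by
    rw [sub_mul, mul_sub, mul_sub, smul_mul_assoc, smul_mul_assoc, mul_smul_comm, mul_smul_comm,
      ← hc2.eq, smul_smul, hprod, ← sq, ← sq, ht']
    module
  have hn : ‖1 - z‖ * ‖1 - starRingEnd ℂ z‖ = t + 2 := by
    have : 1 - starRingEnd ℂ z = starRingEnd ℂ (1 - z) := by simp
    rw [this, Complex.norm_conj, ← sq, ← Complex.normSq_eq_norm_sq, Complex.normSq_apply]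
    simp [hz]; nlinarith
  rw [e, Module.End.mul_apply]
  refine le_trans ?_ (p.norm_one_sub_mul_pow_le hab hc h k z hz1 _)
  calc (t + 2) * (c ^ 2 ^ k) ^ 2 * p W
      = ‖1 - z‖ * c ^ 2 ^ k * (‖1 - starRingEnd ℂ z‖ * c ^ 2 ^ k * p W) := by rw [← hn]; ring
    _ ≤ _ := by
      gcongr
      exact p.norm_one_sub_mul_pow_le hab hc h k _ hzc W

end Seminorm

/-! ### Unitarily invariant norms -/

namespace UnitarilyInvariantNorm

variable {H : Type*} [NormedAddCommGroup H] [InnerProductSpace ℂ H] [CompleteSpace H]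
  (N : UnitarilyInvariantNorm H)

/-- The map `X ↦ S * X * T` as a linear endomorphism of the norm ideal. -/
def sandwich (S T : H →L[ℂ] H) : Module.End ℂ N.ideal where
  toFun X := ⟨S * X * T, N.mul_mul_mem S T X.2⟩
  map_add' X Y := Subtype.ext <| by simp [mul_add, add_mul]
  map_smul' c X := Subtype.ext <| by simp

@[simp] theorem coe_sandwich (S T : H →L[ℂ] H) (X : N.ideal) :
    (N.sandwich S T X : H →L[ℂ] H) = S * X * T := rfl

theorem sandwich_mul_sandwich (S S' T T' : H →L[ℂ] H) :
    N.sandwich S T * N.sandwich S' T' = N.sandwich (S * S') (T' * T) := by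
  ext X : 2
  simp [mul_assoc]

theorem sandwich_pow (S T : H →L[ℂ] H) (n : ℕ) :
    N.sandwich S T ^ n = N.sandwich (S ^ n) (T ^ n) := by
  induction n with
  | zero => ext X : 2; simp
  | succ n ih => rw [pow_succ, ih, sandwich_mul_sandwich, ← pow_succ, ← pow_succ']

/-- The ideal property with constant one, obtained by averaging over unitaries. -/
theorem norm_sandwich_le (S T : H →L[ℂ] H) (X : N.ideal) :
    N.norm (N.sandwich S T X) ≤ ‖S‖ * ‖T‖ * N.norm X := by
  -- left and right multiplication by a unitary preserve the norm
  have hleft : N.norm (N.sandwich S 1 X) ≤ N.norm X * ‖S‖ := by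
    let f : (H →L[ℂ] H) →ₗ[ℂ] N.ideal :=
      { toFun := fun S => N.sandwich S 1 X
        map_add' := fun S T => Subtype.ext <| by simp [add_mul]
        map_smul' := fun c S => Subtype.ext <| by simp }
    exact (N.norm.comp f).le_mul_norm_of_forall_unitary
      (fun U => (N.norm_unitary_mul_mul U 1 X).le) S
  have hright : ∀ Y : N.ideal, N.norm (N.sandwich 1 T Y) ≤ N.norm Y * ‖T‖ := fun Y => by
    let f : (H →L[ℂ] H) →ₗ[ℂ] N.ideal :=
      { toFun := fun T => N.sandwich 1 T Y
        map_add' := fun S T => Subtype.ext <| by simp [mul_add]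
        map_smul' := fun c S => Subtype.ext <| by simp }
    exact (N.norm.comp f).le_mul_norm_of_forall_unitary
      (fun U => (N.norm_unitary_mul_mul 1 U Y).le) T
  have e : N.sandwich S T = N.sandwich 1 T * N.sandwich S 1 := by
    rw [sandwich_mul_sandwich, one_mul, one_mul]
  rw [e, Module.End.mul_apply]
  calc _ ≤ N.norm (N.sandwich S 1 X) * ‖T‖ := hright _
    _ ≤ N.norm X * ‖S‖ * ‖T‖ := by gcongr
    _ = _ := by ring

/-- The map `D X = γ X - X η` is Hermitian for the norm, so `1 + i D` does not decrease it. For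
`s > 0` the map `X ↦ (1 + i s γ) X (1 - i s η) = X + i s D X + s² γ X η` is inverse to a
contraction; the bound for `i s D` up to `O(s²)` yields the one for `i D` by convexity. -/
theorem norm_le_norm_add_I_smul_commutator {γ η : H →L[ℂ] H} (hγ : IsSelfAdjoint γ)
    (hη : IsSelfAdjoint η) (X : N.ideal) :
    N.norm X ≤ N.norm (X + Complex.I • (N.sandwich γ 1 X - N.sandwich 1 η X)) := by
  set Y := X + Complex.I • (N.sandwich γ 1 X - N.sandwich 1 η X) with hY
  set C := N.norm (N.sandwich γ η X) with hC
  have hC0 : 0 ≤ C := apply_nonneg _ _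
  have key : ∀ s : ℝ, 0 < s → s ≤ 1 → N.norm X ≤ N.norm Y + s * C := by
    intro s hs hs1
    have hγs : IsSelfAdjoint (s • γ) := (IsSelfAdjoint.all s).smul hγ
    have hηs : IsSelfAdjoint ((-s) • η) := (IsSelfAdjoint.all (-s)).smul hη
    obtain ⟨K, hK, hK1, -⟩ := hγs.exists_contraction_inverse_one_add_I_smul
    obtain ⟨K', hK', -, hK1'⟩ := hηs.exists_contraction_inverse_one_add_I_smul
    set Z := N.sandwich (1 + Complex.I • s • γ) (1 + Complex.I • (-s) • η) X with hZ
    have h1 : X = N.sandwich K K' Z := by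
      rw [hZ, ← Module.End.mul_apply, sandwich_mul_sandwich, hK1, hK1']
      exact Subtype.ext (by simp)
    have h2 : N.norm X ≤ N.norm Z := by
      calc N.norm X = N.norm (N.sandwich K K' Z) := by rw [← h1]
        _ ≤ ‖K‖ * ‖K'‖ * N.norm Z := N.norm_sandwich_le _ _ _
        _ ≤ 1 * 1 * N.norm Z := by gcongr
        _ = _ := by ring
    -- with `D X = γ X - X η`, the convex combination `(1 - s) X + s Y` is `X + i s D X`
    have h3 : Z = (((1 - s : ℝ) : ℂ) • X + (s : ℂ) • Y) + ((s ^ 2 : ℝ) : ℂ) • N.sandwich γ η X := by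
      refine Subtype.ext ?_
      simp only [hZ, hY, coe_sandwich, Submodule.coe_add, Submodule.coe_sub, Submodule.coe_smul,
        add_mul, mul_add, one_mul, mul_one, smul_mul_assoc, mul_smul_comm, neg_smul, mul_neg,
        smul_neg, ← Complex.coe_smul (x := s)]
      push_cast
      match_scalars
      · ring
      · ring
      · ring
      · linear_combination (-(s : ℂ) ^ 2) * Complex.I_sq
    have h4 : N.norm Z ≤ (1 - s) * N.norm X + s * N.norm Y + s ^ 2 * C := by
      rw [h3]
      refine (map_add_le_add N.norm _ _).trans
        (add_le_add ((map_add_le_add N.norm _ _).trans ?_) ?_)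
      · rw [map_smul_eq_mul, map_smul_eq_mul, Complex.norm_real, Complex.norm_real,
          Real.norm_of_nonneg hs.le, Real.norm_of_nonneg (by linarith)]
      · rw [map_smul_eq_mul, Complex.norm_real, Real.norm_of_nonneg (by positivity)]
    have h5 : s * N.norm X ≤ s * (N.norm Y + s * C) := by nlinarith
    exact le_of_mul_le_mul_left h5 hs
  refine le_of_forall_pos_le_add fun ε hε => ?_
  refine (key (min 1 (ε / (C + 1))) (by positivity) (min_le_left _ _)).trans ?_
  gcongr
  calc min 1 (ε / (C + 1)) * C ≤ ε / (C + 1) * (C + 1) := by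
        gcongr
        · exact min_le_right _ _
        · linarith
    _ = ε := by field_simp

/-- The bound for a single linear factor: for `z ≠ 1` the quotient `(1 + z) / (1 - z)` is `i τ` with
`τ` real, and the factor is `1 - z` times `W + i τ (γ W - W η) - γ W η`. -/
theorem norm_one_sub_mul_le {γ η : H →L[ℂ] H} (hγ : IsSelfAdjoint γ)
    (hη : IsSelfAdjoint η) {z : ℂ} (hz : ‖z‖ = 1) (W : N.ideal) :
    ‖1 - z‖ * (1 - ‖γ‖ * ‖η‖) * N.norm W ≤
      N.norm ((N.sandwich (1 + γ) (1 - η) - z • N.sandwich (1 - γ) (1 + η)) W) := by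
  rcases eq_or_ne z 1 with rfl | hz1
  · simp
  have hne : 1 - z ≠ 0 := sub_ne_zero.2 hz1.symm
  obtain ⟨τ, hτ⟩ : ∃ τ : ℝ, 1 + z = (1 - z) * (Complex.I * τ) := by
    refine ⟨2 * z.im / Complex.normSq (1 - z), ?_⟩
    have hz2 : z * starRingEnd ℂ z = 1 := by
      rw [Complex.mul_conj, Complex.normSq_eq_norm_sq, hz]; simp
    have hne' : starRingEnd ℂ (1 - z) ≠ 0 := (map_ne_zero _).2 hne
    have him : z - starRingEnd ℂ z = 2 * z.im * Complex.I := Complex.sub_conj z |>.trans (by simp)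
    push_cast
    rw [← Complex.mul_conj]
    field_simp
    rw [map_sub, map_one]
    linear_combination him - hz2
  have e : (N.sandwich (1 + γ) (1 - η) - z • N.sandwich (1 - γ) (1 + η)) W
      = (1 - z) • ((W + Complex.I • (N.sandwich (τ • γ) 1 W - N.sandwich 1 (τ • η) W))
        - N.sandwich γ η W) := by
    have h1 : (N.sandwich (1 + γ) (1 - η) - z • N.sandwich (1 - γ) (1 + η)) W
        = (1 - z) • (W - N.sandwich γ η W)
          + (1 + z) • (N.sandwich γ 1 W - N.sandwich 1 η W) := by
      refine Subtype.ext ?_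
      simp only [LinearMap.sub_apply, LinearMap.smul_apply, coe_sandwich, Submodule.coe_add,
        Submodule.coe_sub, Submodule.coe_smul, add_mul, mul_add, sub_mul, mul_sub, one_mul, mul_one]
      module
    rw [h1, hτ]
    refine Subtype.ext ?_
    simp only [coe_sandwich, Submodule.coe_add, Submodule.coe_sub, Submodule.coe_smul, one_mul,
      mul_one, smul_mul_assoc, mul_smul_comm, ← Complex.coe_smul (x := τ)]
    module
  have h2 := N.norm_le_norm_add_I_smul_commutator ((IsSelfAdjoint.all τ).smul hγ)
    ((IsSelfAdjoint.all τ).smul hη) W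
  have h3 := N.norm_sandwich_le γ η W
  rw [e, map_smul_eq_mul, mul_assoc]
  gcongr
  have h4 := map_add_le_add N.norm
    ((W + Complex.I • (N.sandwich (τ • γ) 1 W - N.sandwich 1 (τ • η) W)) - N.sandwich γ η W)
    (N.sandwich γ η W)
  rw [sub_add_cancel] at h4
  linarith

/-- The inequality for positive invertible coefficients, up to the error made with `2 ^ k`-th
roots. -/
theorem add_two_mul_norm_sandwich_exp_le_of_pow {α β : H →L[ℂ] H} (hα : IsSelfAdjoint α)
    (hβ : IsSelfAdjoint β) {t : ℝ} (ht : t ∈ Set.Icc (-2) 2) (X : N.ideal) (k : ℕ)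
    (hk : ‖α‖ * ‖β‖ ≤ 2 ^ k) :
    (t + 2) * (1 - ‖α‖ * ‖β‖ / ((2 : ℝ) ^ k) ^ 2) ^ (2 * 2 ^ k) *
        N.norm (N.sandwich (NormedSpace.exp α) (NormedSpace.exp β) X) ≤
      N.norm ((N.sandwich (NormedSpace.exp α ^ 2) 1 + N.sandwich 1 (NormedSpace.exp β ^ 2) +
        (t : ℂ) • N.sandwich (NormedSpace.exp α) (NormedSpace.exp β)) X) := by
  have hN : 0 < 2 ^ k := by positivity
  set P := NormedSpace.exp α
  set Q := NormedSpace.exp β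
  obtain ⟨γ, hγ, hγn, hγ1, hγu, hγc, hγe⟩ := hα.exists_cayley_root_exp hN
  obtain ⟨η, hη, hηn, hη1, hηu, hηc, hηe⟩ := hβ.exists_cayley_root_exp hN
  push_cast at hγn hηn
  have hc : ‖γ‖ * ‖η‖ ≤ ‖α‖ * ‖β‖ / ((2 : ℝ) ^ k) ^ 2 := by
    calc ‖γ‖ * ‖η‖ ≤ (‖α‖ / 2 ^ k) * (‖β‖ / 2 ^ k) := by gcongr
      _ = _ := by rw [div_mul_div_comm, sq]
  have hd : 0 ≤ 1 - ‖α‖ * ‖β‖ / ((2 : ℝ) ^ k) ^ 2 := by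
    rw [sub_nonneg, div_le_one (by positivity), sq]
    exact hk.trans (le_mul_of_one_le_left (by positivity) (one_le_pow₀ one_le_two))
  set a := N.sandwich (1 + γ) (1 - η) with ha
  set b := N.sandwich (1 - γ) (1 + η) with hb
  have hcomm : ∀ δ : H →L[ℂ] H, Commute (1 + δ) (1 - δ) := fun δ =>
    (Commute.one_left _).add_left ((Commute.one_right δ).sub_right (Commute.refl δ))
  have hγcomm := hcomm γ
  have hηcomm := hcomm η
  have hab : Commute a b := by
    change a * b = b * a
    rw [ha, hb, sandwich_mul_sandwich, sandwich_mul_sandwich, hγcomm.eq, hηcomm.eq]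
  -- `X` is rescaled to `W` so that the terms of the form become powers of `a` and `b`
  obtain ⟨W, hW⟩ : ∃ W, X = N.sandwich ((1 - γ) ^ (2 * 2 ^ k)) ((1 - η) ^ (2 * 2 ^ k)) W := by
    obtain ⟨u, hu⟩ := (hγu.pow (2 * 2 ^ k))
    obtain ⟨v, hv⟩ := (hηu.pow (2 * 2 ^ k))
    refine ⟨N.sandwich ((u⁻¹ : (H →L[ℂ] H)ˣ) : H →L[ℂ] H) ((v⁻¹ : (H →L[ℂ] H)ˣ) : H →L[ℂ] H) X, ?_⟩
    rw [← Module.End.mul_apply, sandwich_mul_sandwich, ← hu, ← hv, Units.mul_inv, Units.inv_mul]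
    exact Subtype.ext (by simp only [coe_sandwich, one_mul, mul_one])
  have hPγ : Commute P ((1 - γ) ^ 2 ^ k) :=
    ((Commute.one_right P).sub_right hγc.symm).pow_right _
  have hQη : Commute Q ((1 - η) ^ 2 ^ k) :=
    ((Commute.one_right Q).sub_right hηc.symm).pow_right _
  have hP2 : P ^ 2 * (1 - γ) ^ (2 * 2 ^ k) = ((1 + γ) ^ 2 ^ k) ^ 2 := by
    rw [mul_comm 2, pow_mul, ← hPγ.mul_pow, hPγ.eq, hγe]
  have hQ2 : (1 - η) ^ (2 * 2 ^ k) * Q ^ 2 = ((1 + η) ^ 2 ^ k) ^ 2 := by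
    rw [mul_comm 2, pow_mul, ← hQη.symm.mul_pow, hηe]
  have hP1 : P * (1 - γ) ^ (2 * 2 ^ k) = (1 + γ) ^ 2 ^ k * (1 - γ) ^ 2 ^ k := by
    rw [mul_comm 2, pow_mul, sq, ← mul_assoc, hPγ.eq, hγe]
  have hQ1 : (1 - η) ^ (2 * 2 ^ k) * Q = (1 - η) ^ 2 ^ k * (1 + η) ^ 2 ^ k := by
    rw [mul_comm 2, pow_mul, sq, mul_assoc, hηe]
  have hPQ : N.sandwich P Q X = (a ^ 2 ^ k * b ^ 2 ^ k) W := by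
    rw [hW, ← Module.End.mul_apply, sandwich_mul_sandwich, ha, hb, sandwich_pow, sandwich_pow,
      sandwich_mul_sandwich, hP1, hQ1, (hηcomm.pow_pow _ _).eq]
  have hPP : N.sandwich (P ^ 2) 1 X = ((a ^ 2 ^ k) ^ 2) W := by
    rw [hW, ← Module.End.mul_apply, sandwich_mul_sandwich, ha, sandwich_pow, sandwich_pow, hP2,
      mul_one, mul_comm 2, pow_mul (1 - η)]
  have hQQ : N.sandwich 1 (Q ^ 2) X = ((b ^ 2 ^ k) ^ 2) W := by
    rw [hW, ← Module.End.mul_apply, sandwich_mul_sandwich, hb, sandwich_pow, sandwich_pow, hQ2,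
      one_mul, mul_comm 2, pow_mul (1 - γ)]
  have hle : N.norm (N.sandwich P Q X) ≤ N.norm W := by
    have hs : a ^ 2 ^ k * b ^ 2 ^ k
        = N.sandwich ((1 - γ ^ 2) ^ 2 ^ k) ((1 - η ^ 2) ^ 2 ^ k) := by
      rw [← hab.mul_pow, ha, hb, sandwich_mul_sandwich, sandwich_pow]
      congr 2 <;> noncomm_ring
    have hpow : ∀ δ : H →L[ℂ] H, ‖δ‖ ≤ 1 → ‖δ ^ 2 ^ k‖ ≤ 1 := fun δ hδ =>
      (norm_pow_le' δ hN).trans (pow_le_one₀ (norm_nonneg _) hδ)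
    rw [hPQ, hs]
    calc _ ≤ _ := N.norm_sandwich_le _ _ W
      _ ≤ 1 * 1 * N.norm W := by
        gcongr
        exacts [hpow _ hγ1, hpow _ hη1]
      _ = _ := by ring
  have hmain := N.norm.add_two_mul_pow_le hab hd (fun z hz W => by
    refine le_trans ?_ (N.norm_one_sub_mul_le hγ hη hz W)
    gcongr) k ht W
  simp only [LinearMap.add_apply, LinearMap.smul_apply] at hmain ⊢
  rw [hPP, hQQ, hPQ]
  refine le_trans ?_ hmain
  rw [← hPQ, mul_comm 2, pow_mul]
  have : 0 ≤ t + 2 := by linarith [ht.1]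
  gcongr

theorem add_two_mul_norm_sandwich_exp_le {α β : H →L[ℂ] H} (hα : IsSelfAdjoint α)
    (hβ : IsSelfAdjoint β) {t : ℝ} (ht : t ∈ Set.Icc (-2) 2) (X : N.ideal) :
    (t + 2) * N.norm (N.sandwich (NormedSpace.exp α) (NormedSpace.exp β) X) ≤
      N.norm ((N.sandwich (NormedSpace.exp α ^ 2) 1 + N.sandwich 1 (NormedSpace.exp β ^ 2) +
        (t : ℂ) • N.sandwich (NormedSpace.exp α) (NormedSpace.exp β)) X) := by
  set C := ‖α‖ * ‖β‖ with hC
  set p := N.norm (N.sandwich (NormedSpace.exp α) (NormedSpace.exp β) X)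
  have hC0 : 0 ≤ C := by positivity
  have hp : 0 ≤ p := apply_nonneg _ _
  have ht0 : 0 ≤ t + 2 := by linarith [ht.1]
  have h2 : Filter.Tendsto (fun k : ℕ => (2 : ℝ) ^ k) Filter.atTop Filter.atTop :=
    tendsto_pow_atTop_atTop_of_one_lt one_lt_two
  have hlim : Filter.Tendsto (fun k : ℕ => (t + 2) * (1 - 2 * C / 2 ^ k) * p) Filter.atTop
      (nhds ((t + 2) * (1 - 0) * p)) :=
    ((((h2.const_div_atTop (2 * C)).const_sub 1).const_mul (t + 2)).mul_const p)
  rw [sub_zero, mul_one] at hlim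
  refine le_of_tendsto hlim ?_
  filter_upwards [h2.eventually_ge_atTop C] with k hk
  refine le_trans ?_ (N.add_two_mul_norm_sandwich_exp_le_of_pow hα hβ ht X k hk)
  gcongr
  have hk0 : (0 : ℝ) < 2 ^ k := by positivity
  have hk1 : (1 : ℝ) ≤ 2 ^ k := one_le_pow₀ one_le_two
  have hle : C / ((2 : ℝ) ^ k) ^ 2 ≤ 1 := by
    rw [div_le_one (by positivity), sq]
    exact hk.trans (le_mul_of_one_le_left hk0.le hk1)
  -- Bernoulli's inequality, with `2 n` factors and `C / n²` in each, for `n = 2 ^ k`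
  have hb := one_add_mul_le_pow (a := -(C / ((2 : ℝ) ^ k) ^ 2)) (by linarith) (2 * 2 ^ k)
  rw [← hC, sub_eq_add_neg 1 (C / _)]
  refine le_trans (le_of_eq ?_) hb
  push_cast
  field_simp
  ring

/-- Passing from `A`, `B` to regularized absolute values does not decrease the norm. -/
theorem norm_sandwich_le_sandwich_abs_add (A B : H →L[ℂ] H) {ε : ℝ} (hε : 0 < ε) (X : N.ideal) :
    N.norm (N.sandwich A (star B) X) ≤
      N.norm (N.sandwich (CFC.abs A + ε • 1) (CFC.abs B + ε • 1) X) := by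
  obtain ⟨K, hK, hKA⟩ := exists_contraction_mul_abs_add_smul_one A hε
  obtain ⟨L, hL, hLB⟩ := exists_contraction_mul_abs_add_smul_one B hε
  have hB : (CFC.abs B + ε • 1) * star L = star B := by
    have h := congrArg star hLB
    rwa [star_mul, star_add, (CFC.abs_nonneg B).isSelfAdjoint.star_eq, star_smul, star_one,
      star_trivial] at h
  have e : N.sandwich A (star B)
      = N.sandwich K (star L) * N.sandwich (CFC.abs A + ε • 1) (CFC.abs B + ε • 1) := by
    rw [sandwich_mul_sandwich, hKA, hB]
  rw [e, Module.End.mul_apply]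
  calc _ ≤ _ := N.norm_sandwich_le _ _ _
    _ ≤ 1 * 1 * N.norm (N.sandwich (CFC.abs A + ε • 1) (CFC.abs B + ε • 1) X) := by
      gcongr
      rwa [norm_star]
    _ = _ := by ring

theorem add_two_mul_norm_sandwich_le (A B : H →L[ℂ] H) {t : ℝ} (ht : t ∈ Set.Icc (-2) 2)
    (X : N.ideal) :
    (t + 2) * N.norm (N.sandwich A (star B) X) ≤
      N.norm ((N.sandwich (star A * A) 1 + N.sandwich 1 (star B * B) +
        (t : ℂ) • N.sandwich (CFC.abs A) (CFC.abs B)) X) := by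
  have ht0 : 0 ≤ t + 2 := by linarith [ht.1]
  set Y := (N.sandwich (star A * A) 1 + N.sandwich 1 (star B * B) +
        (t : ℂ) • N.sandwich (CFC.abs A) (CFC.abs B)) X with hY
  -- replacing `|A|`, `|B|` by `|A| + ε`, `|B| + ε` changes `Y` to `Y + ε • Y₁ + ε ^ 2 • Y₂`
  obtain ⟨Y₁, hY₁⟩ : ∃ Y₁, Y₁ = (2 + t : ℂ) •
      (N.sandwich (CFC.abs A) 1 X + N.sandwich 1 (CFC.abs B) X) := ⟨_, rfl⟩
  obtain ⟨Y₂, hY₂⟩ : ∃ Y₂, Y₂ = (2 + t : ℂ) • X := ⟨_, rfl⟩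
  have key : ∀ ε : ℝ, 0 < ε → (t + 2) * N.norm (N.sandwich A (star B) X) ≤
      N.norm Y + ε * N.norm Y₁ + ε ^ 2 * N.norm Y₂ := by
    intro ε hε
    have hpos : ∀ T : H →L[ℂ] H, IsStrictlyPositive (CFC.abs T + ε • (1 : H →L[ℂ] H)) := fun T =>
      IsStrictlyPositive.nonneg_add (CFC.abs_nonneg T)
        (IsStrictlyPositive.smul hε isStrictlyPositive_one)
    have h := N.add_two_mul_norm_sandwich_exp_le (α := CFC.log (CFC.abs A + ε • 1))
      (β := CFC.log (CFC.abs B + ε • 1)) .log .log ht X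
    rw [CFC.exp_log _ (hpos A), CFC.exp_log _ (hpos B)] at h
    have e : (N.sandwich ((CFC.abs A + ε • 1) ^ 2) 1 + N.sandwich 1 ((CFC.abs B + ε • 1) ^ 2) +
        (t : ℂ) • N.sandwich (CFC.abs A + ε • 1) (CFC.abs B + ε • 1)) X
        = Y + (ε : ℂ) • Y₁ + ((ε ^ 2 : ℝ) : ℂ) • Y₂ := by
      refine Subtype.ext ?_
      simp only [hY, hY₁, hY₂, LinearMap.add_apply, LinearMap.smul_apply, coe_sandwich,
        Submodule.coe_add, Submodule.coe_smul, sq, add_mul, mul_add, one_mul, mul_one,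
        smul_mul_assoc, mul_smul_comm, CFC.abs_mul_abs, ← Complex.coe_smul (x := ε)]
      push_cast
      module
    rw [e] at h
    calc _ ≤ (t + 2) * N.norm (N.sandwich (CFC.abs A + ε • 1) (CFC.abs B + ε • 1) X) := by
          gcongr
          exact N.norm_sandwich_le_sandwich_abs_add A B hε X
      _ ≤ _ := h
      _ ≤ N.norm Y + N.norm ((ε : ℂ) • Y₁) + N.norm (((ε ^ 2 : ℝ) : ℂ) • Y₂) :=
          (map_add_le_add N.norm _ _).trans (add_le_add (map_add_le_add N.norm _ _) le_rfl)
      _ = _ := by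
          rw [map_smul_eq_mul, map_smul_eq_mul, Complex.norm_real, Complex.norm_real,
            Real.norm_of_nonneg hε.le, Real.norm_of_nonneg (by positivity)]
  have hcont : Continuous fun ε : ℝ => N.norm Y + ε * N.norm Y₁ + ε ^ 2 * N.norm Y₂ := by fun_prop
  have hlim := (hcont.tendsto 0).mono_left (nhdsWithin_le_nhds (s := Set.Ioi 0))
  simp only [zero_mul, add_zero, zero_pow two_ne_zero] at hlim
  exact ge_of_tendsto hlim (eventually_mem_nhdsWithin.mono fun ε hε => key ε hε)

end UnitarilyInvariantNorm

theorem mainTheorem3 {H : Type*} [NormedAddCommGroup H] [InnerProductSpace ℂ H] [CompleteSpace H]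
    (N : UnitarilyInvariantNorm H) (A B : H →L[ℂ] H) (t : ℝ) (ht : t ≤ 2)
    (X : H →L[ℂ] H) (hX : X ∈ N.ideal) :
    N.norm ⟨star A * A * X + X * (star B * B) + (t : ℂ) • (CFC.abs A * X * CFC.abs B),
        add_mem (add_mem (N.mul_mem_left _ hX) (N.mul_mem_right _ hX))
          (N.ideal.smul_mem _ (N.mul_mul_mem _ _ hX))⟩
      ≥ (t + 2) * N.norm ⟨A * X * star B, N.mul_mul_mem _ _ hX⟩ := by
  rcases le_total t (-2) with h | h
  · exact (mul_nonpos_of_nonpos_of_nonneg (by linarith) (apply_nonneg _ _)).trans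
      (apply_nonneg _ _)
  · refine (N.add_two_mul_norm_sandwich_le A B ⟨h, ht⟩ ⟨X, hX⟩).trans_eq ?_
    congr 1
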